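/- Let $d\ge 2$, let $2\le n_1<n_2<\dots<n_d$ be integers, and let $\Lambda\subset\prod_{q=1}^d\{0,\dots,n_q-1\}$ be non-empty. For $\bar\imath=(i_1,\dots,i_d)\in\Lambda$ put $$\varphi_{\bar\imath}(x_1,\dots,x_d)=\Big(\frac{x_1+i_1}{n_1},\dots,\frac{x_d+i_d}{n_d}\Big),$$ and let $F$ be the associated Bedford–McMullen sponge, i.e. the limit set of the iterated function system $\{\varphi_{\bar\imath}\}_{\bar\imath\in\Lambda}$. Assume the very strong separation condition: if $\bar\imath,\bar\jmath\in\Lambda$ satisfy $i_k=j_k$ for all $k<q$ and $i_q\neq j_q$ for some $q\in\{1,\dots,d\}$, then $|i_q-j_q|>1$. Let $(p_{\bar\imath})_{\bar\imath\in\Lambda}$ be a probability vector with all $p_{\bar\imath}>0$, and let $\mu$ be the corresponding self-affine measure, i.e. the push-forward under the coding map $\pi:\Lambda^{\mathbb N}\to F$, $\pi(\bar\imath_1,\bar\imath_2,\dots)=\big(\sum_{t\ge1} i_{t,q}\,n_q^{-t}\big)_{q=1}^d$, of the Bernoulli measure on $\Lambda^{\mathbb N}$ with weights $p_{\bar\imath}$;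 equivalently, the Borel probability measure with $\mu=\sum_{\bar\imath\in\Lambda}p_{\bar\imath}\,\mu\circ\varphi_{\bar\imath}^{-1}$. For $1\le q\le d$ and $\bar\imath\in\Lambda$ let $$p_q(\bar\imath)=\frac{\sum_{\bar\jmath\in\Lambda:\ j_k=i_k,\ k\le q}p_{\bar\jmath}}{\sum_{\bar\jmath\in\Lambda:\ j_k=i_k,\ k\le q-1}p_{\bar\jmath}}.$$ With closed Euclidean balls $B(x,r)$, let $\dim_{\mathrm A}(\mu,x)$ be the infimum of all $s>0$ for which there is a constant $C=C(x)>0$ with $\mu(B(x,R))/\mu(B(x,r))\le C(R/r)^s$ for all $0<r<R$, and let $\dim_{\mathrm A}\mu$ be the infimum of all $s>0$ for which there is one constant $C>0$ such that this holds for all $x\in\operatorname{supp}\mu$ and all $0<r<R$. Then $$\dim_{\mathrm A}\mu=\sum_{q=1}^d\max_{\bar\imath\in\Lambda}\frac{-\log p_q(\bar\imath)}{\log n_q},$$ and $$\dim_{\mathrm A}(\mu,x)=\dim_{\mathrm A}\mu\qquad\text{for }\mu\text{-almost every }x\in F.$$ -/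

import Mathlib

open MeasureTheory Metric
open scoped ENNReal

noncomputable section

/-! ### Assouad dimensions of measures -/

section Assouad

variable {X : Type*} [PseudoMetricSpace X] [MeasurableSpace X]

/-- The pointwise Assouad dimension `dim_A(μ, x)`: the infimum (in `[0, ∞]`, with `inf ∅ = ∞`) of
all `s > 0` for which there is `C > 0` such that
`μ (B(x, R)) / μ (B(x, r)) ≤ C * (R / r) ^ s` for all `0 < r < R`, where `B` is a closed ball. -/
def pointwiseAssouadDim (μ : Measure X) (x : X) : ℝ≥0∞ :=
  sInf {σ : ℝ≥0∞ | ∃ s : ℝ, 0 < s ∧ σ = ENNReal.ofReal s ∧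
    ∃ C : ℝ, 0 < C ∧ ∀ r R : ℝ, 0 < r → r < R →
      μ (closedBall x R) / μ (closedBall x r) ≤ ENNReal.ofReal (C * (R / r) ^ s)}

/-- The (global) Assouad dimension `dim_A μ` of a measure `μ`: as above, but with one constant `C`
for all points `x` of the support of `μ`. -/
def assouadDim (μ : Measure X) : ℝ≥0∞ :=
  sInf {σ : ℝ≥0∞ | ∃ s : ℝ, 0 < s ∧ σ = ENNReal.ofReal s ∧
    ∃ C : ℝ, 0 < C ∧ ∀ x ∈ μ.support, ∀ r R : ℝ, 0 < r → r < R →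
      μ (closedBall x R) / μ (closedBall x r) ≤ ENNReal.ofReal (C * (R / r) ^ s)}

end Assouad

/-! ### Bedford–McMullen sponges and their self-affine measures -/

namespace BedfordMcMullen

variable {d : ℕ} {n : Fin d → ℕ}

/-- The affine map `φ_i (x_1, …, x_d) = ((x_1 + i_1) / n_1, …, (x_d + i_d) / n_d)`. -/
def affineContraction (i : (q : Fin d) → Fin (n q)) (x : EuclideanSpace ℝ (Fin d)) :
    EuclideanSpace ℝ (Fin d) :=
  WithLp.toLp 2 fun q => (x q + ((i q : ℕ) : ℝ)) / (n q : ℝ)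

/-- The coding map `π : Λ^ℕ → ℝ^d`, whose `q`-th coordinate is the number with base-`n_q` digits
`i_{1,q}, i_{2,q}, …`; see `codingMap_cons` for its relation to the maps `φ_i`. -/
def codingMap (Λ : Finset ((q : Fin d) → Fin (n q))) (ω : ℕ → Λ) : EuclideanSpace ℝ (Fin d) :=
  WithLp.toLp 2 fun q => ∑' t : ℕ, (((ω t).1 q : ℕ) : ℝ) / (n q : ℝ) ^ (t + 1)

/-- The sponge `F = π(Λ^ℕ)`; by `isCompact_sponge` and `sponge_eq_iUnion` it is the limit set of
the iterated function system `(φ_i)_{i ∈ Λ}`. -/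
def sponge (Λ : Finset ((q : Fin d) → Fin (n q))) : Set (EuclideanSpace ℝ (Fin d)) :=
  Set.range (codingMap Λ)

/-- The self-affine measure `μ = π_* ν`, where `ν` is the Bernoulli measure on `Λ^ℕ` with
probability vector `p`; by `selfAffineMeasure_eq_sum` it satisfies `μ = ∑ i, p_i • (φ_i)_* μ`. -/
def selfAffineMeasure (Λ : Finset ((q : Fin d) → Fin (n q))) (p : PMF Λ) :
    Measure (EuclideanSpace ℝ (Fin d)) :=
  (Measure.infinitePi fun _ : ℕ => p.toMeasure).map (codingMap Λ)

/-- The very strong separation condition: if two words of `Λ` agree in all coordinates before `q`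
and differ in coordinate `q`, then their `q`-th coordinates differ by more than `1`. -/
def VSSC (Λ : Finset ((q : Fin d) → Fin (n q))) : Prop :=
  ∀ i ∈ Λ, ∀ j ∈ Λ, ∀ q : Fin d, (∀ k < q, i k = j k) → i q ≠ j q →
    1 < |((i q : ℕ) : ℤ) - ((j q : ℕ) : ℤ)|

/-- The conditional probability `p_q(i) = p(i_q | i_1, …, i_{q-1})`. -/
def condProb (Λ : Finset ((q : Fin d) → Fin (n q))) (p : PMF Λ) (q : Fin d) (i : Λ) : ℝ :=
  (∑ j : Λ with ∀ k ≤ q, j.1 k = i.1 k, (p j).toReal) /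
    ∑ j : Λ with ∀ k < q, j.1 k = i.1 k, (p j).toReal

variable {Λ : Finset ((q : Fin d) → Fin (n q))}

lemma digit_le (ω : ℕ → Λ) (q : Fin d) (t : ℕ) :
    (((ω t).1 q : ℕ) : ℝ) / (n q : ℝ) ^ (t + 1) ≤ (1 / (n q : ℝ)) ^ t := by
  have h := ((ω t).1 q).isLt
  have h0 : (0 : ℝ) < n q := by exact_mod_cast (by omega : 0 < n q)
  rw [div_pow, one_pow, pow_succ, div_le_div_iff₀ (by positivity) (by positivity)]
  have : (((ω t).1 q : ℕ) : ℝ) ≤ n q := by exact_mod_cast h.le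
  nlinarith [pow_pos h0 t]

lemma summable_bound (hn : ∀ q, 2 ≤ n q) (q : Fin d) :
    Summable fun t : ℕ => (1 / (n q : ℝ)) ^ t := by
  have h2 : (2 : ℝ) ≤ n q := by exact_mod_cast hn q
  refine summable_geometric_of_lt_one (by positivity) ?_
  rw [div_lt_one (by linarith)]
  linarith

lemma summable_digits (hn : ∀ q, 2 ≤ n q) (ω : ℕ → Λ) (q : Fin d) :
    Summable fun t : ℕ => (((ω t).1 q : ℕ) : ℝ) / (n q : ℝ) ^ (t + 1) :=
  (summable_bound hn q).of_nonneg_of_le (fun _ => by positivity) (digit_le ω q)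

lemma continuous_codingMap (hn : ∀ q, 2 ≤ n q) : Continuous (codingMap Λ) := by
  refine (PiLp.continuous_toLp 2 _).comp (continuous_pi fun q => ?_)
  refine continuous_tsum (fun t => ?_) (summable_bound hn q) (fun t ω => ?_)
  · exact (continuous_of_discreteTopology
      (f := fun i : Λ => ((i.1 q : ℕ) : ℝ) / (n q : ℝ) ^ (t + 1))).comp (continuous_apply t)
  · rw [Real.norm_of_nonneg (by positivity)]
    exact digit_le ω q t

lemma measurable_codingMap (hn : ∀ q, 2 ≤ n q) : Measurable (codingMap Λ) := by
  have : BorelSpace Λ := ⟨by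
    rw [borel_eq_top_of_discrete]; exact eq_top_iff.2 fun s _ => s.to_countable.measurableSet⟩
  exact (continuous_codingMap hn).measurable

/-- The word `iω` obtained by putting the letter `i` in front of `ω`. -/
def consWord (i : Λ) (ω : ℕ → Λ) : ℕ → Λ
  | 0 => i
  | t + 1 => ω t

lemma codingMap_cons (hn : ∀ q, 2 ≤ n q) (i : Λ) (ω : ℕ → Λ) :
    codingMap Λ (consWord i ω) = affineContraction i.1 (codingMap Λ ω) := by
  ext q
  have h2 : (n q : ℝ) ≠ 0 := by
    have := hn q
    exact_mod_cast (by omega : n q ≠ 0)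
  simp only [codingMap, affineContraction]
  rw [(summable_digits hn (consWord i ω) q).tsum_eq_zero_add, add_comm, add_div, ← tsum_div_const]
  congr 1
  · refine tsum_congr fun t => ?_
    simp only [consWord]
    rw [div_div, ← pow_succ]
  · simp [consWord]

lemma isCompact_sponge (hn : ∀ q, 2 ≤ n q) : IsCompact (sponge Λ) :=
  isCompact_range (continuous_codingMap hn)

lemma sponge_eq_iUnion (hn : ∀ q, 2 ≤ n q) :
    sponge Λ = ⋃ i : Λ, affineContraction i.1 '' sponge Λ := by
  ext x
  simp only [sponge, Set.mem_range, Set.mem_iUnion, Set.mem_image, exists_exists_eq_and]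
  constructor
  · rintro ⟨ω, rfl⟩
    refine ⟨ω 0, fun t => ω (t + 1), ?_⟩
    rw [← codingMap_cons hn]
    congr 1
    funext t
    cases t <;> rfl
  · rintro ⟨i, ω, rfl⟩
    exact ⟨consWord i ω, codingMap_cons hn i ω⟩

lemma measurable_consWord (i : Λ) : Measurable (consWord i) := by
  refine measurable_pi_lambda _ fun t => ?_
  cases t with
  | zero => exact measurable_const
  | succ t => exact measurable_pi_apply t

lemma bernoulli_eq_sum (p : PMF Λ) :
    (Measure.infinitePi fun _ : ℕ => p.toMeasure) =
      ∑ i : Λ, p i • (Measure.infinitePi fun _ : ℕ => p.toMeasure).map (consWord i) := by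
  symm
  refine Measure.eq_infinitePi _ fun s t ht => ?_
  classical
  obtain ⟨N, hN⟩ := s.exists_nat_subset_range
  have hN' : s ⊆ Finset.range (N + 1) :=
    hN.trans (Finset.range_subset_range.2 (Nat.le_succ N))
  set u : ℕ → Set Λ := fun k => if k ∈ s then t k else Set.univ with hu
  have hum (k : ℕ) : MeasurableSet (u k) := (u k).to_countable.measurableSet
  have hbox : Set.pi (s : Set ℕ) t = Set.pi (Finset.range (N + 1) : Set ℕ) u := by
    ext ω
    simp only [Set.mem_pi, Finset.mem_coe, hu]
    constructor
    · intro h k _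
      split_ifs with hk
      · exact h k hk
      · trivial
    · intro h k hk
      simpa [hk] using h k (hN' hk)
  have hprod : ∏ k ∈ s, p.toMeasure (t k) = ∏ k ∈ Finset.range (N + 1), p.toMeasure (u k) := by
    rw [← Finset.prod_subset hN' (fun k _ hk => by simp [hu, hk])]
    exact Finset.prod_congr rfl fun k hk => by simp [hu, hk]
  have hpre (i : Λ) : consWord i ⁻¹' Set.pi (Finset.range (N + 1) : Set ℕ) u =
      if i ∈ u 0 then Set.pi (Finset.range N : Set ℕ) (fun k => u (k + 1)) else ∅ := by
    ext ω
    have key : ω ∈ consWord i ⁻¹' Set.pi (Finset.range (N + 1) : Set ℕ) u ↔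
        i ∈ u 0 ∧ ∀ k < N, ω k ∈ u (k + 1) := by
      simp only [Set.mem_preimage, Set.mem_pi, Finset.mem_coe, Finset.mem_range]
      constructor
      · intro h
        exact ⟨h 0 (by omega), fun k hk => h (k + 1) (by omega)⟩
      · rintro ⟨h0, h⟩ (_ | k) hk
        · exact h0
        · exact h k (by omega)
    rw [key]
    split_ifs with hi <;> simp [hi]
  rw [hprod, Finset.prod_range_succ', hbox, Measure.finsetSum_apply,
    PMF.toMeasure_apply_fintype, Finset.mul_sum]
  refine Finset.sum_congr rfl fun i _ => ?_
  rw [Measure.smul_apply, Measure.map_apply (measurable_consWord i)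
    (MeasurableSet.pi (Finset.countable_toSet _) fun k _ => hum k), hpre, smul_eq_mul]
  split_ifs with hi
  · rw [Measure.infinitePi_pi _ fun k _ => hum (k + 1), Set.indicator_of_mem hi, mul_comm]
  · simp [hi]

lemma selfAffineMeasure_eq_sum (hn : ∀ q, 2 ≤ n q) (p : PMF Λ) :
    selfAffineMeasure Λ p =
      ∑ i : Λ, p i • (selfAffineMeasure Λ p).map (affineContraction i.1) := by
  have hφ (i : Λ) : Measurable (affineContraction i.1) := by
    unfold affineContraction
    fun_prop
  have hπ := measurable_codingMap (Λ := Λ) hn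
  unfold selfAffineMeasure
  conv_lhs => rw [bernoulli_eq_sum p]
  rw [Measure.map_finset_sum hπ.aemeasurable]
  refine Finset.sum_congr rfl fun i _ => ?_
  rw [Measure.map_smul, Measure.map_map hπ (measurable_consWord i), Measure.map_map (hφ i) hπ]
  congr 2
  funext ω
  exact codingMap_cons hn i ω

end BedfordMcMullen

end

/-! Replace Euclidean balls by approximate cubes: the words agreeing with `ω` in coordinate `q` for
the first `Nat.log (n q) N` digits. The images of such words lie within a constant times `1 / N` of
that of `ω`, and by very strong separation a point of the sponge closer than `1 / N` has its word in
the cube. Since the bases increase, the coordinates constrained at a given position form an initial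
segment, so the conditional probabilities telescope and the Bernoulli measure of a cube is a double
product of `condProb` (`real_approxCube`). Passing from scale `N` to `N * M` multiplies it by the
`condProb` factors over one window of about `log M / log (n q)` positions for each `q`.

Let `s q` be the maximum in the theorem. Every factor is at least `(n q) ^ (-s q)`, with equality at
some letter `v q`; the first fact gives the upper bound uniformly in the point
(`real_closedBall_le_mul`). For the lower bound, fix `M`. The windows have length bounded in `N`,
and for large `N` those of different `q` are disjoint because the bases differ. Along a sparse
sequence of scales, the events "the letter is `v q` throughout window `q`" are thus independent with
probabilities bounded below, so by Borel–Cantelli almost every word realises one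
(`ae_exists_window`). There the ball ratio is at least a constant times `M ^ ∑ q, s q`, and `M` is
arbitrary. -/

/-! ### Distances between digit expansions -/

namespace Real

/-- At position `t` the digits differ by at least 2, while the two tails can make up for at most one
unit of that position. -/
lemma inv_pow_le_abs_ofDigits_sub {b : ℕ} {x y : ℕ → Fin b} {t : ℕ} (hxy : ∀ i < t, x i = y i)
    (ht : 1 < |((x t : ℕ) : ℤ) - ((y t : ℕ) : ℤ)|) :
    ((b : ℝ) ^ (t + 1))⁻¹ ≤ |ofDigits x - ofDigits y| := by
  have hb : (0 : ℝ) < b := by exact_mod_cast Fin.pos (x 0)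
  rw [ofDigits_eq_sum_add_ofDigits x (t + 1), ofDigits_eq_sum_add_ofDigits y (t + 1),
    Finset.sum_range_succ, Finset.sum_range_succ,
    Finset.sum_congr rfl fun i hi => show ofDigitsTerm x i = ofDigitsTerm y i by
      simp [ofDigitsTerm, hxy i (Finset.mem_range.1 hi)]]
  set X := ofDigits fun i => x (i + (t + 1))
  set Y := ofDigits fun i => y (i + (t + 1))
  have hX0 : 0 ≤ X := ofDigits_nonneg _
  have hX1 : X ≤ 1 := ofDigits_le_one _
  have hY0 : 0 ≤ Y := ofDigits_nonneg _
  have hY1 : Y ≤ 1 := ofDigits_le_one _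
  have h2 : (2 : ℝ) ≤ |((x t : ℕ) : ℝ) - ((y t : ℕ) : ℝ)| := by exact_mod_cast ht
  have hXY : |X - Y| ≤ 1 := abs_sub_le_iff.2 ⟨by linarith, by linarith⟩
  set s := ∑ i ∈ Finset.range t, ofDigitsTerm y i
  rw [show s + ofDigitsTerm x t + ((b : ℝ) ^ (t + 1))⁻¹ * X -
      (s + ofDigitsTerm y t + ((b : ℝ) ^ (t + 1))⁻¹ * Y) =
      ((b : ℝ) ^ (t + 1))⁻¹ * ((((x t : ℕ) : ℝ) - ((y t : ℕ) : ℝ)) - (Y - X)) by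
    simp only [ofDigitsTerm]; ring, abs_mul, abs_of_pos (by positivity)]
  refine le_mul_of_one_le_right (by positivity) ?_
  have := abs_sub_abs_le_abs_sub (((x t : ℕ) : ℝ) - ((y t : ℕ) : ℝ)) (Y - X)
  rw [abs_sub_comm Y X] at this
  linarith

end Real

lemma EuclideanSpace.dist_le_sum_abs {ι : Type*} [Fintype ι] (x y : EuclideanSpace ℝ ι) :
    dist x y ≤ ∑ i, |x i - y i| := by
  rw [EuclideanSpace.dist_eq]
  refine Real.sqrt_le_iff.2 ⟨Finset.sum_nonneg fun _ _ => abs_nonneg _, ?_⟩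
  simp only [Real.dist_eq]
  exact Finset.sum_sq_le_sq_sum_of_nonneg fun _ _ => abs_nonneg _

lemma EuclideanSpace.abs_sub_le_dist {ι : Type*} [Fintype ι] (x y : EuclideanSpace ℝ ι) (i : ι) :
    |x i - y i| ≤ dist x y := by
  rw [dist_eq_norm]
  simpa using PiLp.norm_apply_le (x - y) i

/-! ### Approximate cubes versus distance -/

namespace BedfordMcMullen

variable {d : ℕ} {n : Fin d → ℕ} {Λ : Finset ((q : Fin d) → Fin (n q))}

lemma codingMap_apply (ω : ℕ → Λ) (q : Fin d) :
    codingMap Λ ω q = Real.ofDigits fun t => (ω t).1 q := by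
  simp [codingMap, Real.ofDigits, Real.ofDigitsTerm, div_eq_mul_inv]

/-- The approximate cube of side about `1 / N` around `ω`, as a set of words. -/
def approxCube (ω : ℕ → Λ) (N : ℕ) : Set (ℕ → Λ) :=
  {ω' | ∀ q, ∀ t < Nat.log (n q) N, (ω' t).1 q = (ω t).1 q}

/-- The sum of the bases, a convenient bound for the distortion of approximate cubes. -/
noncomputable def baseSum (n : Fin d → ℕ) : ℝ := ∑ q, (n q : ℝ)

lemma le_baseSum (q : Fin d) : (n q : ℝ) ≤ baseSum n :=
  Finset.single_le_sum (f := fun q => (n q : ℝ)) (fun _ _ => Nat.cast_nonneg _) (Finset.mem_univ q)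

lemma dist_le_of_mem_approxCube (hn : ∀ q, 2 ≤ n q) {ω ω' : ℕ → Λ} {N : ℕ} (hN : 0 < N)
    (h : ω' ∈ approxCube ω N) : dist (codingMap Λ ω') (codingMap Λ ω) ≤ baseSum n / N := by
  refine (EuclideanSpace.dist_le_sum_abs _ _).trans ?_
  rw [baseSum, Finset.sum_div]
  refine Finset.sum_le_sum fun q _ => ?_
  have hN' : (0 : ℝ) < N := by exact_mod_cast hN
  have hq : (0 : ℝ) < n q := by
    have := hn q
    exact_mod_cast (by omega : 0 < n q)
  rw [codingMap_apply, codingMap_apply]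
  refine (Real.abs_ofDigits_sub_ofDigits_le (h q)).trans ?_
  have : (N : ℝ) < (n q : ℝ) ^ (Nat.log (n q) N + 1) := by
    exact_mod_cast Nat.lt_pow_succ_log_self (by have := hn q; omega) N
  rw [inv_eq_one_div, div_le_div_iff₀ (by positivity) hN', one_mul, ← pow_succ']
  exact this.le

/-- Look at the first position `t` carrying a constrained disagreement, and at the least coordinate
`q` disagreeing there. Separation then applies at `(t, q)` and forces distance at least `(n q) ^ -(t
+ 1) ≥ 1 / N`. -/
lemma mem_approxCube_of_dist_lt (hmono : StrictMono n)
    (hsep : VSSC Λ) {ω ω' : ℕ → Λ} {N : ℕ}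
    (h : dist (codingMap Λ ω') (codingMap Λ ω) * N < 1) : ω' ∈ approxCube ω N := by
  by_contra hmem
  have hN : N ≠ 0 := by
    rintro rfl
    simp [approxCube] at hmem
  have hex : ∃ t, ∃ q, t < Nat.log (n q) N ∧ (ω' t).1 q ≠ (ω t).1 q := by
    simp only [approxCube, Set.mem_ofPred_eq, not_forall] at hmem
    obtain ⟨q, t, h1, h2⟩ := hmem
    exact ⟨t, q, h1, h2⟩
  classical
  set t := Nat.find hex
  have hmin : ∀ s < t, ∀ q, s < Nat.log (n q) N → (ω' s).1 q = (ω s).1 q := by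
    intro s hs q hq
    have := Nat.find_min hex hs
    push Not at this
    exact this q hq
  obtain ⟨q, ⟨hq, hne⟩, hqmin⟩ :=
    WellFounded.has_min (wellFounded_lt (α := Fin d))
      {q | t < Nat.log (n q) N ∧ (ω' t).1 q ≠ (ω t).1 q} (Nat.find_spec hex)
  -- A coordinate `k < q` has the smaller base, hence the deeper constraint, so it is still
  -- constrained at `t` and minimality of `q` gives agreement. If `n k ≤ 1`, there is only one
  -- digit.
  have hsep' := hsep _ (ω' t).2 _ (ω t).2 q (fun k hk => by
    by_contra hkne
    have hnk := ((ω t).1 k).isLt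
    by_cases hk1 : 1 < n k
    · exact hqmin k ⟨hq.trans_le (Nat.log_anti_left hk1 (hmono hk).le), hkne⟩ hk
    · have := ((ω' t).1 k).isLt
      exact hkne (Fin.ext (by omega))) hne
  have h1 := Real.inv_pow_le_abs_ofDigits_sub (x := fun s => (ω' s).1 q) (y := fun s => (ω s).1 q)
    (fun s hs => hmin s hs q (hs.trans hq)) hsep'
  rw [← codingMap_apply, ← codingMap_apply] at h1
  have h2 := h1.trans (EuclideanSpace.abs_sub_le_dist _ _ q)
  have h3 : ((n q : ℝ) ^ (t + 1)) ≤ N := by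
    exact_mod_cast Nat.pow_le_of_le_log hN hq
  have hpos : (0 : ℝ) < n q := by exact_mod_cast Fin.pos ((ω t).1 q)
  have h4 : (1 : ℝ) ≤ ((n q : ℝ) ^ (t + 1))⁻¹ * N := by
    rw [inv_mul_eq_div, le_div_iff₀ (by positivity), one_mul]
    exact h3
  have := mul_le_mul_of_nonneg_right h2 (Nat.cast_nonneg (α := ℝ) N)
  linarith

lemma injective_codingMap (hn : ∀ q, 2 ≤ n q) (hmono : StrictMono n) (hsep : VSSC Λ) :
    Function.Injective (codingMap Λ) := by
  intro ω' ω h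
  funext t
  refine Subtype.ext (funext fun q => ?_)
  -- At scale `n q ^ (t + 1)` the cube constrains exactly the positions `0, …, t` of coordinate `q`.
  have hq : 1 < n q := by have := hn q; omega
  refine mem_approxCube_of_dist_lt hmono hsep (N := n q ^ (t + 1)) (by simp [h]) q t ?_
  rw [Nat.log_pow hq]
  exact t.lt_succ_self

lemma measurableEmbedding_codingMap (hn : ∀ q, 2 ≤ n q) (hmono : StrictMono n) (hsep : VSSC Λ) :
    MeasurableEmbedding (codingMap Λ) := by
  have : BorelSpace Λ := ⟨by
    rw [borel_eq_top_of_discrete]; exact eq_top_iff.2 fun s _ => s.to_countable.measurableSet⟩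
  exact ((continuous_codingMap hn).isClosedEmbedding
    (injective_codingMap hn hmono hsep)).measurableEmbedding

/-! ### Bernoulli measure of approximate cubes -/

/-- The total weight of the letters that agree with `i` in the first `m` coordinates. -/
noncomputable def prefixSum (p : PMF Λ) (m : ℕ) (i : Λ) : ℝ :=
  ∑ j : Λ with ∀ k : Fin d, k.val < m → j.1 k = i.1 k, (p j).toReal

lemma toReal_pos {p : PMF Λ} (hp : ∀ i, 0 < p i) (i : Λ) : 0 < (p i).toReal :=
  ENNReal.toReal_pos (hp i).ne' (p.apply_ne_top i)

lemma prefixSum_pos {p : PMF Λ} (hp : ∀ i, 0 < p i) (m : ℕ) (i : Λ) : 0 < prefixSum p m i :=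
  Finset.sum_pos (fun j _ => toReal_pos hp j) ⟨i, by simp⟩

lemma prefixSum_succ_le (p : PMF Λ) (m : ℕ) (i : Λ) : prefixSum p (m + 1) i ≤ prefixSum p m i := by
  refine Finset.sum_le_sum_of_subset_of_nonneg (fun j hj => ?_) fun _ _ _ => ENNReal.toReal_nonneg
  simp only [Finset.mem_filter, Finset.mem_univ, true_and] at hj ⊢
  exact fun k hk => hj k (hk.trans m.lt_succ_self)

lemma condProb_eq (p : PMF Λ) (q : Fin d) (i : Λ) :
    condProb Λ p q i = prefixSum p (q.val + 1) i / prefixSum p q.val i := by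
  unfold condProb prefixSum
  congr! 4
  exact imp_congr_left Nat.lt_succ_iff.symm

lemma condProb_pos {p : PMF Λ} (hp : ∀ i, 0 < p i) (q : Fin d) (i : Λ) : 0 < condProb Λ p q i := by
  rw [condProb_eq]
  exact div_pos (prefixSum_pos hp _ _) (prefixSum_pos hp _ _)

lemma condProb_le_one {p : PMF Λ} (hp : ∀ i, 0 < p i) (q : Fin d) (i : Λ) :
    condProb Λ p q i ≤ 1 := by
  rw [condProb_eq]
  exact div_le_one_of_le₀ (prefixSum_succ_le p _ i) (prefixSum_pos hp _ _).le

lemma prefixSum_zero (p : PMF Λ) (i : Λ) : prefixSum p 0 i = 1 := by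
  have h := p.tsum_coe
  rw [tsum_fintype] at h
  simp only [prefixSum, Nat.not_lt_zero, false_imp_iff, implies_true, Finset.filter_true]
  rw [← ENNReal.toReal_sum fun j _ => p.apply_ne_top j, h, ENNReal.toReal_one]

lemma prefixSum_eq_prod {p : PMF Λ} (hp : ∀ i, 0 < p i) (i : Λ) {m : ℕ} (hm : m ≤ d) :
    prefixSum p m i = ∏ q : Fin d with q.val < m, condProb Λ p q i := by
  induction m with
  | zero => simp [prefixSum_zero]
  | succ m ih =>
    have h : (Finset.univ.filter fun q : Fin d => q.val < m + 1) =
        insert ⟨m, hm⟩ (Finset.univ.filter fun q : Fin d => q.val < m) := by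
      ext q
      simp only [Finset.mem_filter, Finset.mem_univ, true_and, Finset.mem_insert, Fin.ext_iff]
      omega
    rw [h, Finset.prod_insert (by simp), ← ih (by omega), condProb_eq,
      div_mul_cancel₀ _ (prefixSum_pos hp _ _).ne']

lemma exists_forall_iff_val_lt {P : Fin d → Prop} (hP : ∀ k q, k ≤ q → P q → P k) :
    ∃ m ≤ d, ∀ q, P q ↔ q.val < m := by
  by_cases h : ∀ q, P q
  · exact ⟨d, le_rfl, fun q => by simp [h q]⟩
  · push Not at h
    obtain ⟨q₀, h₀, hmin⟩ := WellFounded.has_min (wellFounded_lt (α := Fin d)) {q | ¬ P q} h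
    refine ⟨q₀.val, q₀.isLt.le, fun q => ⟨fun hq => ?_, fun hq => ?_⟩⟩
    · by_contra hlt
      exact h₀ (hP q₀ q (not_lt.1 hlt) hq)
    · by_contra hq'
      exact hmin q hq' hq

lemma real_toMeasure_eq_prod {p : PMF Λ} (hp : ∀ i, 0 < p i) (i : Λ) {P : Fin d → Prop}
    [DecidablePred P] (hP : ∀ k q, k ≤ q → P q → P k) :
    p.toMeasure.real {j | ∀ q, P q → j.1 q = i.1 q} = ∏ q with P q, condProb Λ p q i := by
  obtain ⟨m, hm, hiff⟩ := exists_forall_iff_val_lt hP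
  simp only [hiff]
  rw [← prefixSum_eq_prod hp i hm, prefixSum, Measure.real, PMF.toMeasure_apply_fintype,
    ENNReal.toReal_sum fun j _ => ?_, Finset.sum_filter]
  · refine Finset.sum_congr rfl fun j _ => ?_
    simp only [Set.indicator_apply, Set.mem_ofPred_eq]
    split_ifs <;> simp
  · rw [Set.indicator_apply]
    split_ifs
    · exact p.apply_ne_top j
    · simp

lemma log_anti (hn : ∀ q, 2 ≤ n q) (hmono : StrictMono n) (N : ℕ) {k q : Fin d} (h : k ≤ q) :
    Nat.log (n q) N ≤ Nat.log (n k) N :=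
  Nat.log_anti_left (by have := hn k; omega) (hmono.monotone h)

lemma real_approxCube (hn : ∀ q, 2 ≤ n q) (hmono : StrictMono n) {p : PMF Λ} (hp : ∀ i, 0 < p i)
    (ω : ℕ → Λ) (N : ℕ) :
    (Measure.infinitePi fun _ : ℕ => p.toMeasure).real (approxCube ω N) =
      ∏ q, ∏ t ∈ Finset.range (Nat.log (n q) N), condProb Λ p q (ω t) := by
  -- Any common bound for the depths would do; positions beyond the depths carry no constraint.
  set K := ∑ q, Nat.log (n q) N
  have hK (q : Fin d) : Nat.log (n q) N ≤ K :=
    Finset.single_le_sum (f := fun q => Nat.log (n q) N) (fun _ _ => Nat.zero_le _)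
      (Finset.mem_univ q)
  have hset : approxCube ω N = Set.pi (Finset.range K : Set ℕ)
      fun t => {j : Λ | ∀ q, t < Nat.log (n q) N → j.1 q = (ω t).1 q} := by
    ext ω'
    simp only [approxCube, Set.mem_ofPred_eq, Set.mem_pi, Finset.mem_coe, Finset.mem_range]
    exact ⟨fun h t _ q => h q t, fun h q t ht => h t (ht.trans_le (hK q)) q ht⟩
  rw [hset, Measure.real, Measure.infinitePi_pi _ fun _ _ => (Set.to_countable _).measurableSet,
    ENNReal.toReal_prod]
  have (t : ℕ) := real_toMeasure_eq_prod hp (ω t) (P := fun q => t < Nat.log (n q) N)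
    fun k q hkq h => h.trans_le (log_anti hn hmono N hkq)
  simp only [Measure.real] at this
  simp only [this]
  refine Finset.prod_comm' fun t q => ?_
  simp only [Finset.mem_range, Finset.mem_filter, Finset.mem_univ, true_and, and_true]
  exact ⟨fun h => h.2, fun h => ⟨h.trans_le (hK q), h⟩⟩

lemma real_approxCube_pos (hn : ∀ q, 2 ≤ n q) (hmono : StrictMono n) {p : PMF Λ}
    (hp : ∀ i, 0 < p i) (ω : ℕ → Λ) (N : ℕ) :
    0 < (Measure.infinitePi fun _ : ℕ => p.toMeasure).real (approxCube ω N) := by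
  rw [real_approxCube hn hmono hp]
  exact Finset.prod_pos fun q _ => Finset.prod_pos fun t _ => condProb_pos hp q _

lemma real_approxCube_mul (hn : ∀ q, 2 ≤ n q) (hmono : StrictMono n) {p : PMF Λ}
    (hp : ∀ i, 0 < p i) (ω : ℕ → Λ) {N N' : ℕ} (hN : N ≤ N') :
    (Measure.infinitePi fun _ : ℕ => p.toMeasure).real (approxCube ω N) *
        ∏ q, ∏ t ∈ Finset.Ico (Nat.log (n q) N) (Nat.log (n q) N'), condProb Λ p q (ω t) =
      (Measure.infinitePi fun _ : ℕ => p.toMeasure).real (approxCube ω N') := by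
  rw [real_approxCube hn hmono hp, real_approxCube hn hmono hp, ← Finset.prod_mul_distrib]
  exact Finset.prod_congr rfl fun q _ =>
    Finset.prod_range_mul_prod_Ico _ (Nat.log_mono_right hN)

end BedfordMcMullen

/-! ### Window lengths and comparison of balls with cubes -/

/-- Bounds the window between the outer scale `1 / (2 * R)`, whose cube contains the ball of radius
`R`, and the inner scale `D / r`, whose cube lies in the ball of radius `r`. For `r > D` the inner
scale is at most 1 and the window is empty. -/
lemma Nat.pow_log_sub_log_le {b : ℕ} (hb : 2 ≤ b) {D r R : ℝ} (hD : 1 ≤ D) (hr : 0 < r)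
    (hrR : r < R) :
    ((b ^ (Nat.log b ⌈D / r⌉₊ - Nat.log b ⌊1 / (2 * R)⌋₊) : ℕ) : ℝ) ≤ 4 * D * b * (R / r) := by
  have hR : 0 < R := hr.trans hrR
  have hb' : (2 : ℝ) ≤ b := by exact_mod_cast hb
  have hRr : 1 ≤ R / r := (one_le_div hr).2 hrR.le
  rcases le_or_gt r D with h | h
  · set N := ⌊1 / (2 * R)⌋₊
    set N' := ⌈D / r⌉₊
    have hNN' : N ≤ N' := by
      have h1 : 1 / (2 * R) ≤ D / r := by
        rw [div_le_div_iff₀ (by positivity) hr]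
        nlinarith
      exact (Nat.floor_le_floor h1).trans (Nat.floor_le_ceil _)
    have hlog : Nat.log b N ≤ Nat.log b N' := Nat.log_mono_right hNN'
    have hN' : N' ≠ 0 := (Nat.ceil_pos.2 (by positivity)).ne'
    have h1 : ((b ^ Nat.log b N' : ℕ) : ℝ) ≤ 2 * (D / r) := by
      have h2 : ((b ^ Nat.log b N' : ℕ) : ℝ) ≤ N' := by
        exact_mod_cast Nat.pow_log_le_self b hN'
      have h3 : (N' : ℝ) < D / r + 1 := Nat.ceil_lt_add_one (by positivity)
      have h4 : 1 ≤ D / r := (one_le_div hr).2 h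
      linarith
    have h2 : 1 / (2 * R) ≤ ((b ^ (Nat.log b N + 1) : ℕ) : ℝ) := by
      refine (Nat.lt_floor_add_one _).le.trans ?_
      exact_mod_cast Nat.lt_pow_succ_log_self (by omega) N
    have h3 : b ^ (Nat.log b N' - Nat.log b N) * b ^ (Nat.log b N + 1) =
        b ^ Nat.log b N' * b := by
      rw [← pow_add, ← pow_succ]
      congr 1
      omega
    have h4 : ((b ^ (Nat.log b N' - Nat.log b N) : ℕ) : ℝ) * (1 / (2 * R)) ≤
        2 * (D / r) * b := by
      calc _ ≤ ((b ^ (Nat.log b N' - Nat.log b N) : ℕ) : ℝ) *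
            ((b ^ (Nat.log b N + 1) : ℕ) : ℝ) := by gcongr
        _ = ((b ^ Nat.log b N' : ℕ) : ℝ) * b := by exact_mod_cast h3
        _ ≤ _ := by gcongr
    rw [mul_one_div, div_le_iff₀ (by positivity)] at h4
    calc _ ≤ _ := h4
      _ = _ := by ring
  · have : ⌈D / r⌉₊ ≤ 1 := Nat.ceil_le.2 (by
      rw [Nat.cast_one]
      exact (div_le_one hr).2 h.le)
    have h0 : Nat.log b ⌈D / r⌉₊ = 0 := Nat.log_of_lt (by omega)
    rw [h0, Nat.zero_sub, pow_zero, Nat.cast_one]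
    have : 1 ≤ 4 * D * b := by nlinarith
    nlinarith

lemma Nat.le_pow_log_mul_sub_log_succ {b : ℕ} (hb : 2 ≤ b) {N M : ℕ} (hN : 0 < N) (hM : 0 < M) :
    M ≤ b ^ (Nat.log b (N * M) - Nat.log b N + 1) := by
  have hlog : Nat.log b N ≤ Nat.log b (N * M) :=
    Nat.log_mono_right (Nat.le_mul_of_pos_right N hM)
  have h1 : N * M < b ^ (Nat.log b (N * M) + 1) := Nat.lt_pow_succ_log_self (by omega) _
  have h2 : b ^ Nat.log b N ≤ N := Nat.pow_log_le_self b hN.ne'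
  have h3 : b ^ (Nat.log b (N * M) + 1) =
      b ^ Nat.log b N * b ^ (Nat.log b (N * M) - Nat.log b N + 1) := by
    rw [← pow_add]
    congr 1
    omega
  refine le_of_mul_le_mul_left ?_ hN
  rw [h3] at h1
  exact h1.le.trans (Nat.mul_le_mul_right _ h2)

lemma MeasureTheory.measure_div_le_ofReal_iff {X : Type*} [MeasurableSpace X] {μ : Measure X}
    [IsFiniteMeasure μ] {A B : Set X} (hB : 0 < μ.real B) {c : ℝ} (hc : 0 ≤ c) :
    μ A / μ B ≤ ENNReal.ofReal c ↔ μ.real A ≤ c * μ.real B := by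
  rw [← ofReal_measureReal, ← ofReal_measureReal, ← ENNReal.ofReal_div_of_pos hB,
    ENNReal.ofReal_le_ofReal_iff hc, div_le_iff₀ hB]

namespace BedfordMcMullen

variable {d : ℕ} {n : Fin d → ℕ} {Λ : Finset ((q : Fin d) → Fin (n q))}

lemma two_le_baseSum (hd : 0 < d) (hn : ∀ q, 2 ≤ n q) : 2 ≤ baseSum n :=
  le_trans (by exact_mod_cast hn ⟨0, hd⟩) (le_baseSum ⟨0, hd⟩)

lemma isProbabilityMeasure_selfAffineMeasure (hn : ∀ q, 2 ≤ n q) (p : PMF Λ) :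
    IsProbabilityMeasure (selfAffineMeasure Λ p) :=
  Measure.isProbabilityMeasure_map (measurable_codingMap hn).aemeasurable

lemma real_approxCube_le_real_closedBall (hn : ∀ q, 2 ≤ n q) (p : PMF Λ) (ω : ℕ → Λ) {N : ℕ}
    (hN : 0 < N) {r : ℝ} (hr : baseSum n / N ≤ r) :
    (Measure.infinitePi fun _ : ℕ => p.toMeasure).real (approxCube ω N) ≤
      (selfAffineMeasure Λ p).real (closedBall (codingMap Λ ω) r) := by
  rw [selfAffineMeasure, map_measureReal_apply (measurable_codingMap hn) measurableSet_closedBall]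
  exact measureReal_mono fun ω' h => (dist_le_of_mem_approxCube hn hN h).trans hr

lemma real_closedBall_le_real_approxCube (hn : ∀ q, 2 ≤ n q) (hmono : StrictMono n)
    (hsep : VSSC Λ) (p : PMF Λ) (ω : ℕ → Λ) {N : ℕ} {R : ℝ} (hR : R * N < 1) :
    (selfAffineMeasure Λ p).real (closedBall (codingMap Λ ω) R) ≤
      (Measure.infinitePi fun _ : ℕ => p.toMeasure).real (approxCube ω N) := by
  rw [selfAffineMeasure, map_measureReal_apply (measurable_codingMap hn) measurableSet_closedBall]
  refine measureReal_mono fun ω' h => mem_approxCube_of_dist_lt hmono hsep (lt_of_le_of_lt ?_ hR)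
  exact mul_le_mul_of_nonneg_right h (Nat.cast_nonneg _)

lemma real_closedBall_pos (hn : ∀ q, 2 ≤ n q) (hmono : StrictMono n) {p : PMF Λ}
    (hp : ∀ i, 0 < p i) (ω : ℕ → Λ) {r : ℝ} (hr : 0 < r) :
    0 < (selfAffineMeasure Λ p).real (closedBall (codingMap Λ ω) r) := by
  obtain ⟨N, hN⟩ := exists_nat_gt (max 0 (baseSum n / r))
  have hN0 : (0 : ℝ) < N := (le_max_left _ _).trans_lt hN
  refine (real_approxCube_pos hn hmono hp ω N).trans_le
    (real_approxCube_le_real_closedBall hn p ω (by exact_mod_cast hN0) ?_)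
  rw [div_le_comm₀ hN0 hr]
  exact ((le_max_right _ _).trans_lt hN).le

lemma real_closedBall_le_mul (hd : 0 < d) (hn : ∀ q, 2 ≤ n q) (hmono : StrictMono n)
    (hsep : VSSC Λ) {p : PMF Λ} (hp : ∀ i, 0 < p i) {s : Fin d → ℝ} (hs0 : ∀ q, 0 ≤ s q)
    (hs : ∀ q i, (n q : ℝ) ^ (-s q) ≤ condProb Λ p q i) :
    ∃ C : ℝ, 0 < C ∧ ∀ (ω : ℕ → Λ) (r R : ℝ), 0 < r → r < R →
      (selfAffineMeasure Λ p).real (closedBall (codingMap Λ ω) R) ≤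
        C * (R / r) ^ (∑ q, s q) * (selfAffineMeasure Λ p).real (closedBall (codingMap Λ ω) r) := by
  have hD : 2 ≤ baseSum n := two_le_baseSum hd hn
  have hn0 (q : Fin d) : (0 : ℝ) < n q := by
    have := hn q
    exact_mod_cast (by omega : 0 < n q)
  set D := baseSum n
  have hc (q : Fin d) : 0 < 4 * D * n q := mul_pos (by linarith) (hn0 q)
  refine ⟨∏ q, (4 * D * n q) ^ s q, Finset.prod_pos fun q _ => Real.rpow_pos_of_pos (hc q) _,
    fun ω r R hr hrR => ?_⟩
  have hR : 0 < R := hr.trans hrR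
  -- The factor 2 makes `R * N < 1` strict. For large `R` this is `N = 0`, whose cube is the whole
  -- space.
  set N := ⌊1 / (2 * R)⌋₊
  set N' := ⌈D / r⌉₊
  have hRr : 0 < R / r := by positivity
  have hN' : 0 < N' := Nat.ceil_pos.2 (by positivity)
  have hNN' : N ≤ N' := by
    have h1 : 1 / (2 * R) ≤ D / r := by
      rw [div_le_div_iff₀ (by positivity) hr]
      nlinarith
    exact (Nat.floor_le_floor h1).trans (Nat.floor_le_ceil _)
  have hin : D / N' ≤ r := by
    rw [div_le_comm₀ (by exact_mod_cast hN') hr]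
    exact Nat.le_ceil _
  have hout : R * N < 1 := by
    have : (N : ℝ) ≤ 1 / (2 * R) := Nat.floor_le (by positivity)
    calc R * N ≤ R * (1 / (2 * R)) := by gcongr
      _ = 1 / 2 := by field_simp
      _ < 1 := by norm_num
  have hprod : (∏ q, ((4 * D * n q) ^ s q * (R / r) ^ s q))⁻¹ ≤
      ∏ q, ∏ t ∈ Finset.Ico (Nat.log (n q) N) (Nat.log (n q) N'), condProb Λ p q (ω t) := by
    rw [← Finset.prod_inv_distrib]
    refine Finset.prod_le_prod (fun q _ => ?_) fun q _ => ?_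
    · have := hc q
      positivity
    · calc ((4 * D * n q) ^ s q * (R / r) ^ s q)⁻¹ = (4 * D * n q * (R / r)) ^ (-s q) := by
            rw [Real.rpow_neg (mul_pos (hc q) hRr).le, Real.mul_rpow (hc q).le hRr.le]
        _ ≤ ((n q ^ (Nat.log (n q) N' - Nat.log (n q) N) : ℕ) : ℝ) ^ (-s q) := by
            refine Real.rpow_le_rpow_of_nonpos ?_
              (Nat.pow_log_sub_log_le (hn q) (by linarith) hr hrR) (neg_nonpos.2 (hs0 q))
            exact_mod_cast pow_pos (by have := hn q; omega : 0 < n q) _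
        _ = ∏ t ∈ Finset.Ico (Nat.log (n q) N) (Nat.log (n q) N'), (n q : ℝ) ^ (-s q) := by
            rw [Finset.prod_const, Nat.card_Ico, Nat.cast_pow, ← Real.rpow_natCast,
              ← Real.rpow_natCast, ← Real.rpow_mul (hn0 q).le, ← Real.rpow_mul (hn0 q).le, mul_comm]
        _ ≤ _ := Finset.prod_le_prod (fun t _ => (Real.rpow_pos_of_pos (hn0 q) _).le)
            fun t _ => hs q _
  rw [Finset.prod_mul_distrib, ← Real.rpow_sum_of_pos hRr] at hprod
  have hpos : 0 < (∏ q, (4 * D * n q) ^ s q) * (R / r) ^ (∑ q, s q) :=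
    mul_pos (Finset.prod_pos fun q _ => Real.rpow_pos_of_pos (hc q) _)
      (Real.rpow_pos_of_pos hRr _)
  refine (real_closedBall_le_real_approxCube hn hmono hsep p ω hout).trans ?_
  refine le_trans ?_ (mul_le_mul_of_nonneg_left
    (real_approxCube_le_real_closedBall hn p ω hN' hin) hpos.le)
  rw [← real_approxCube_mul hn hmono hp ω hNN', mul_left_comm]
  refine le_mul_of_one_le_right measureReal_nonneg ?_
  rw [← inv_le_iff_one_le_mul₀' hpos]
  exact hprod

/-- When every factor in the windows takes the extremal value, the ratio of the cubes at scales `N`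
and `N * M` is at least `M ^ ∑ q, s q` up to the rounding factor `∏ q, n q ^ s q`, which depends on
neither `N` nor `M`. -/
lemma real_closedBall_mul_le (hn : ∀ q, 2 ≤ n q) (hmono : StrictMono n)
    (hsep : VSSC Λ) {p : PMF Λ} (hp : ∀ i, 0 < p i) {s : Fin d → ℝ} (hs0 : ∀ q, 0 ≤ s q)
    {ω : ℕ → Λ} {N M : ℕ} (hN : 0 < N) (hM : 0 < M)
    (hω : ∀ q, ∀ t ∈ Finset.Ico (Nat.log (n q) N) (Nat.log (n q) (N * M)),
      condProb Λ p q (ω t) = (n q : ℝ) ^ (-s q)) :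
    (M : ℝ) ^ (∑ q, s q) *
        (selfAffineMeasure Λ p).real (closedBall (codingMap Λ ω) (1 / (2 * (N * M)))) ≤
      (∏ q, (n q : ℝ) ^ s q) *
        (selfAffineMeasure Λ p).real (closedBall (codingMap Λ ω) (baseSum n / N)) := by
  have hn0 (q : Fin d) : (0 : ℝ) < n q := by
    have := hn q
    exact_mod_cast (by omega : 0 < n q)
  have hM' : (0 : ℝ) < M := by exact_mod_cast hM
  have hN' : (0 : ℝ) < N := by exact_mod_cast hN
  have hprod : ∏ q, ∏ t ∈ Finset.Ico (Nat.log (n q) N) (Nat.log (n q) (N * M)),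
      condProb Λ p q (ω t) ≤ ∏ q, ((n q : ℝ) ^ s q / (M : ℝ) ^ s q) := by
    refine Finset.prod_le_prod
      (fun q _ => Finset.prod_nonneg fun t _ => (condProb_pos hp _ _).le) fun q _ => ?_
    rw [Finset.prod_congr rfl (hω q), Finset.prod_const, Nat.card_Ico]
    set Δ := Nat.log (n q) (N * M) - Nat.log (n q) N
    have h1 : (M : ℝ) / n q ≤ (n q : ℝ) ^ Δ := by
      rw [div_le_iff₀ (hn0 q), ← pow_succ]
      exact_mod_cast Nat.le_pow_log_mul_sub_log_succ (hn q) hN hM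
    calc ((n q : ℝ) ^ (-s q)) ^ Δ = ((n q : ℝ) ^ Δ) ^ (-s q) := by
          rw [← Real.rpow_natCast, ← Real.rpow_natCast, ← Real.rpow_mul (hn0 q).le,
            ← Real.rpow_mul (hn0 q).le, mul_comm]
      _ ≤ ((M : ℝ) / n q) ^ (-s q) :=
          Real.rpow_le_rpow_of_nonpos (div_pos hM' (hn0 q)) h1 (neg_nonpos.2 (hs0 q))
      _ = _ := by
          rw [Real.rpow_neg (div_pos hM' (hn0 q)).le, Real.div_rpow hM'.le (hn0 q).le, inv_div]
  rw [Finset.prod_div_distrib, ← Real.rpow_sum_of_pos hM',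
    le_div_iff₀ (Real.rpow_pos_of_pos hM' _)] at hprod
  have hout : 1 / (2 * ((N : ℝ) * M)) * ((N * M : ℕ) : ℝ) < 1 := by
    push_cast
    rw [one_div_mul_eq_div, div_lt_one (by positivity)]
    linarith [mul_pos hN' hM']
  have h1 := real_closedBall_le_real_approxCube hn hmono hsep p ω hout
  rw [← real_approxCube_mul hn hmono hp ω (Nat.le_mul_of_pos_right N hM)] at h1
  have h2 := real_approxCube_le_real_closedBall hn p ω hN le_rfl
  have hMS := Real.rpow_pos_of_pos hM' (∑ q, s q)
  refine (mul_le_mul_of_nonneg_left h1 hMS.le).trans ?_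
  rw [mul_comm, mul_assoc, mul_comm]
  exact mul_le_mul hprod h2 measureReal_nonneg
    (Finset.prod_nonneg fun q _ => (Real.rpow_pos_of_pos (hn0 q) _).le)

end BedfordMcMullen

/-! ### Disjoint windows and Borel–Cantelli -/

open Filter in
lemma Nat.eventually_le_log {b : ℕ} (hb : 1 < b) (T : ℕ) : ∀ᶠ N in atTop, T ≤ Nat.log b N := by
  filter_upwards [eventually_ge_atTop (b ^ T)] with N hN
  exact Nat.le_log_of_pow_le hb hN

open Filter in
-- With `k = Nat.log c (N * M)` large, `(b / c) ^ k ≤ 1 / M`, so `b ^ k * M ≤ c ^ k ≤ N * M`.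
lemma Nat.eventually_log_mul_le_log {b c : ℕ} (hb : 1 < b) (hbc : b < c) {M : ℕ} (hM : 0 < M) :
    ∀ᶠ N in atTop, Nat.log c (N * M) ≤ Nat.log b N := by
  have hc0 : (0 : ℝ) < c := by exact_mod_cast (by omega : 0 < c)
  have hM0 : (0 : ℝ) < M := by exact_mod_cast hM
  have hlim := tendsto_pow_atTop_nhds_zero_of_lt_one (r := (b : ℝ) / c) (by positivity)
    ((div_lt_one hc0).2 (by exact_mod_cast hbc))
  obtain ⟨k₀, hk₀⟩ := eventually_atTop.1
    (hlim.eventually (eventually_le_nhds (show (0 : ℝ) < 1 / M by positivity)))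
  filter_upwards [Nat.eventually_le_log (hb.trans hbc) k₀, eventually_gt_atTop 0] with N hN hN0
  set k := Nat.log c (N * M)
  have hk : k₀ ≤ k := hN.trans (Nat.log_mono_right (Nat.le_mul_of_pos_right N hM))
  have h1 := hk₀ k hk
  rw [div_pow, div_le_div_iff₀ (by positivity) hM0, one_mul] at h1
  have h2 : b ^ k * M ≤ c ^ k := by exact_mod_cast h1
  have h3 : c ^ k ≤ N * M := Nat.pow_log_le_self c (Nat.mul_pos hN0 hM).ne'
  exact Nat.le_log_of_pow_le hb (Nat.le_of_mul_le_mul_right (h2.trans h3) hM)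

/-- Crude, from `M < b ^ M`; only independence of `N` matters. -/
lemma Nat.log_mul_le_log_add {b : ℕ} (hb : 2 ≤ b) (N M : ℕ) :
    Nat.log b (N * M) ≤ Nat.log b N + M := by
  have h1 : N * M < b ^ (Nat.log b N + M + 1) := by
    have h2 : N < b ^ (Nat.log b N + 1) := Nat.lt_pow_succ_log_self (by omega) N
    have h3 : M < b ^ M := Nat.lt_pow_self (by omega)
    calc N * M < b ^ (Nat.log b N + 1) * b ^ M := Nat.mul_lt_mul'' h2 h3
      _ = _ := by rw [← pow_add]; congr 1; omega
  exact Nat.lt_succ_iff.1 (Nat.log_lt_of_lt_pow' (by omega) h1)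

lemma exists_pattern {ι α β : Type*} [Nonempty β] {W : ι → Finset α}
    (hW : Pairwise fun i j => Disjoint (W i) (W j)) (v : ι → β) :
    ∃ a : α → β, ∀ i, ∀ t ∈ W i, a t = v i := by
  classical
  refine ⟨fun t => if h : ∃ i, t ∈ W i then v h.choose else Classical.arbitrary β,
    fun i t ht => ?_⟩
  have h : ∃ i, t ∈ W i := ⟨i, ht⟩
  simp only [dif_pos h]
  congr 1
  by_contra hne
  exact Finset.disjoint_left.1 (hW hne) h.choose_spec ht

open ProbabilityTheory Filter in
-- Disjoint blocks give independent events, each of probability at least `(min p) ^ K`, so the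
-- second Borel–Cantelli lemma applies.
lemma PMF.ae_exists_forall_mem_eq {α : Type*} [Finite α] [MeasurableSpace α]
    [MeasurableSingletonClass α] {p : PMF α} (hp : ∀ i, 0 < p i) {T : ℕ → Finset ℕ}
    (hT : Pairwise fun i j => Disjoint (T i) (T j)) {K : ℕ} (hK : ∀ j, (T j).card ≤ K)
    (a : ℕ → α) :
    ∀ᵐ ω ∂(Measure.infinitePi fun _ : ℕ => p.toMeasure), ∃ j, ∀ t ∈ T j, ω t = a t := by
  set ν := Measure.infinitePi fun _ : ℕ => p.toMeasure
  have : Nonempty α := ⟨a 0⟩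
  obtain ⟨i₀, hi₀⟩ := Finite.exists_min p
  have hbox (S : Finset ℕ) : ν (Set.pi (S : Set ℕ) fun t => {a t}) = ∏ t ∈ S, p (a t) := by
    rw [Measure.infinitePi_pi _ fun _ _ => measurableSet_singleton _]
    exact Finset.prod_congr rfl fun t _ => PMF.toMeasure_apply_singleton _ _
      (measurableSet_singleton _)
  set A : ℕ → Set (ℕ → α) := fun j => Set.pi (T j : Set ℕ) fun t => {a t} with hA
  have hmeas (j : ℕ) : MeasurableSet (A j) :=
    MeasurableSet.pi (Finset.countable_toSet _) fun _ _ => measurableSet_singleton _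
  have hind : iIndepSet A ν := by
    classical
    rw [iIndepSet_iff_meas_biInter hmeas]
    intro s
    have : ⋂ j ∈ s, A j = Set.pi (s.biUnion T : Set ℕ) fun t => {a t} := by
      ext ω
      simp only [hA, Set.mem_iInter, Set.mem_pi, Finset.mem_coe, Finset.mem_biUnion]
      exact ⟨fun h t ⟨j, hj, ht⟩ => h j hj t ht, fun h j hj t ht => h t ⟨j, hj, ht⟩⟩
    rw [this, hbox, Finset.prod_biUnion fun i _ j _ hij => hT hij]
    exact Finset.prod_congr rfl fun j _ => (hbox _).symm
  have hlow (j : ℕ) : p i₀ ^ K ≤ ν (A j) := by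
    rw [hbox]
    calc p i₀ ^ K ≤ p i₀ ^ (T j).card := pow_le_pow_right_of_le_one' (p.coe_le_one _) (hK j)
      _ ≤ _ := Finset.pow_card_le_prod _ _ _ fun t _ => hi₀ _
  have hsum : ∑' j, ν (A j) = ∞ := by
    refine top_unique (le_trans ?_ (ENNReal.tsum_le_tsum hlow))
    rw [ENNReal.tsum_const_eq_top_of_ne_zero (ENNReal.pow_pos (hp i₀) K).ne']
  have hae : ∀ᵐ ω ∂ν, ω ∈ limsup A atTop :=
    (mem_ae_iff_prob_eq_one (MeasurableSet.measurableSet_limsup hmeas)).2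
      (measure_limsup_eq_one hmeas hind hsum)
  filter_upwards [hae] with ω hω
  obtain ⟨j, hj⟩ := (mem_limsup_iff_frequently_mem.1 hω).exists
  exact ⟨j, fun t ht => hj t ht⟩

namespace BedfordMcMullen

variable {d : ℕ} {n : Fin d → ℕ} {Λ : Finset ((q : Fin d) → Fin (n q))}

open Filter in
lemma exists_scales (hn : ∀ q, 2 ≤ n q) (hmono : StrictMono n) {M : ℕ} (hM : 0 < M) :
    ∃ f : ℕ → ℕ, (∀ j, 0 < f j) ∧ Pairwise fun x y : ℕ × Fin d =>
      Disjoint (Finset.Ico (Nat.log (n x.2) (f x.1)) (Nat.log (n x.2) (f x.1 * M)))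
        (Finset.Ico (Nat.log (n y.2) (f y.1)) (Nat.log (n y.2) (f y.1 * M))) := by
  have hn1 (q : Fin d) : 1 < n q := by have := hn q; omega
  obtain ⟨f, hf, hff⟩ := exists_seq_of_forall_finset_exists
    -- Within one scale, the window of the larger base ends before that of the smaller base starts;
    -- across scales, all windows of the earlier one end before any of the later one starts.
    (fun N => 0 < N ∧ ∀ k q, k < q → Nat.log (n q) (N * M) ≤ Nat.log (n k) N)
    (fun N N' => ∀ k q, Nat.log (n k) (N * M) ≤ Nat.log (n q) N') (fun s _ => by
      have h1 : ∀ᶠ N in atTop, ∀ k q, k < q → Nat.log (n q) (N * M) ≤ Nat.log (n k) N := by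
        simp only [eventually_all]
        exact fun k q hkq => Nat.eventually_log_mul_le_log (hn1 k) (hmono hkq) hM
      have h2 : ∀ᶠ N' in atTop, ∀ N ∈ s, ∀ k q, Nat.log (n k) (N * M) ≤ Nat.log (n q) N' := by
        rw [Finset.eventually_all]
        simp only [eventually_all]
        exact fun N _ k q => Nat.eventually_le_log (hn1 q) _
      obtain ⟨N, h0, h1, h2⟩ := ((eventually_gt_atTop 0).and (h1.and h2)).exists
      exact ⟨N, ⟨h0, h1⟩, h2⟩)
  refine ⟨f, fun j => (hf j).1, fun x y hxy => ?_⟩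
  have key {x y : ℕ × Fin d} (h : Nat.log (n x.2) (f x.1 * M) ≤ Nat.log (n y.2) (f y.1)) :
      Disjoint (Finset.Ico (Nat.log (n x.2) (f x.1)) (Nat.log (n x.2) (f x.1 * M)))
        (Finset.Ico (Nat.log (n y.2) (f y.1)) (Nat.log (n y.2) (f y.1 * M))) := by
    rw [Finset.disjoint_left]
    intro t h1 h2
    rw [Finset.mem_Ico] at h1 h2
    omega
  obtain ⟨i, k⟩ := x
  obtain ⟨j, q⟩ := y
  rcases lt_trichotomy i j with h | rfl | h
  · exact key (hff i j h k q)
  · rcases lt_trichotomy k q with h' | rfl | h'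
    · exact (key ((hf i).2 k q h')).symm
    · exact absurd rfl hxy
    · exact key ((hf i).2 q k h')
  · exact (key (hff j i h q k)).symm

lemma ae_exists_window (hn : ∀ q, 2 ≤ n q) (hmono : StrictMono n) [Nonempty Λ] {p : PMF Λ}
    (hp : ∀ i, 0 < p i) (v : Fin d → Λ) {M : ℕ} (hM : 0 < M) :
    ∀ᵐ ω ∂(Measure.infinitePi fun _ : ℕ => p.toMeasure), ∃ N, 0 < N ∧
      ∀ q, ∀ t ∈ Finset.Ico (Nat.log (n q) N) (Nat.log (n q) (N * M)), ω t = v q := by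
  obtain ⟨f, hf0, hf⟩ := exists_scales hn hmono hM
  obtain ⟨a, ha⟩ := exists_pattern hf fun x => v x.2
  set T : ℕ → Finset ℕ := fun j => Finset.univ.biUnion fun q =>
    Finset.Ico (Nat.log (n q) (f j)) (Nat.log (n q) (f j * M)) with hT
  have hdisj : Pairwise fun i j => Disjoint (T i) (T j) := by
    intro i j hij
    simp only [hT, Finset.disjoint_biUnion_left, Finset.disjoint_biUnion_right]
    exact fun k _ q _ => @hf (i, q) (j, k) fun h => hij (congrArg Prod.fst h)
  have hcard (j : ℕ) : (T j).card ≤ d * M := by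
    refine Finset.card_biUnion_le.trans ((Finset.sum_le_card_nsmul _ _ M fun q _ => ?_).trans ?_)
    · rw [Nat.card_Ico]
      have := Nat.log_mul_le_log_add (hn q) (f j) M
      omega
    · simp
  filter_upwards [PMF.ae_exists_forall_mem_eq hp hdisj hcard a] with ω ⟨j, hj⟩
  refine ⟨f j, hf0 j, fun q t ht => ?_⟩
  rw [hj t (Finset.mem_biUnion.2 ⟨q, Finset.mem_univ q, ht⟩), ha (j, q) t ht]

end BedfordMcMullen

/-! ### From ball ratios to dimensions -/

/-- Approaching `S` strictly from above also covers `S = 0`, which is not itself an admissible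
exponent. -/
lemma ENNReal.sInf_le_ofReal_of_forall_lt {P : ℝ → Prop} {S : ℝ} (hS : 0 ≤ S)
    (h : ∀ s, S < s → P s) :
    sInf {σ : ℝ≥0∞ | ∃ s : ℝ, 0 < s ∧ σ = ENNReal.ofReal s ∧ P s} ≤ ENNReal.ofReal S := by
  refine ENNReal.le_of_forall_pos_le_add fun ε hε _ => ?_
  have hε' : (0 : ℝ) < ε := hε
  rw [← ENNReal.ofReal_coe_nnreal, ← ENNReal.ofReal_add hS hε'.le]
  exact sInf_le ⟨S + ε, by linarith, rfl, h _ (by linarith)⟩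

lemma pointwiseAssouadDim_le_assouadDim {X : Type*} [PseudoMetricSpace X] [MeasurableSpace X]
    {μ : Measure X} {x : X} (hx : x ∈ μ.support) : pointwiseAssouadDim μ x ≤ assouadDim μ :=
  sInf_le_sInf fun _ ⟨s, hs, hσ, C, hC, h⟩ => ⟨s, hs, hσ, C, hC, h x hx⟩

open Filter in
lemma Real.le_of_forall_nat_rpow_le {S s K : ℝ}
    (h : ∀ M : ℕ, 0 < M → (M : ℝ) ^ S ≤ K * (M : ℝ) ^ s) : S ≤ s := by
  by_contra! hlt
  have hlim := (tendsto_rpow_atTop (sub_pos.2 hlt)).comp (tendsto_natCast_atTop_atTop (R := ℝ))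
  obtain ⟨M, hM, hM0⟩ :=
    ((hlim.eventually (eventually_gt_atTop K)).and (eventually_gt_atTop 0)).exists
  have hM' : (0 : ℝ) < M := by exact_mod_cast hM0
  have h1 := h M hM0
  simp only [Function.comp_apply] at hM
  rw [Real.rpow_sub hM', lt_div_iff₀ (Real.rpow_pos_of_pos hM' _)] at hM
  linarith

namespace BedfordMcMullen

variable {d : ℕ} {n : Fin d → ℕ} {Λ : Finset ((q : Fin d) → Fin (n q))}

lemma exists_measure_ratio_le (hd : 0 < d) (hn : ∀ q, 2 ≤ n q) (hmono : StrictMono n)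
    (hsep : VSSC Λ) {p : PMF Λ} (hp : ∀ i, 0 < p i) {s : Fin d → ℝ} (hs0 : ∀ q, 0 ≤ s q)
    (hs : ∀ q i, (n q : ℝ) ^ (-s q) ≤ condProb Λ p q i) {S : ℝ} (hS : ∑ q, s q ≤ S) :
    ∃ C : ℝ, 0 < C ∧ ∀ x ∈ sponge Λ, ∀ r R : ℝ, 0 < r → r < R →
      selfAffineMeasure Λ p (closedBall x R) / selfAffineMeasure Λ p (closedBall x r) ≤
        ENNReal.ofReal (C * (R / r) ^ S) := by
  have := isProbabilityMeasure_selfAffineMeasure hn p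
  obtain ⟨C, hC, h⟩ := real_closedBall_le_mul hd hn hmono hsep hp hs0 hs
  refine ⟨C, hC, ?_⟩
  rintro _ ⟨ω, rfl⟩ r R hr hrR
  have hRr : 1 ≤ R / r := (one_le_div hr).2 hrR.le
  rw [measure_div_le_ofReal_iff (real_closedBall_pos hn hmono hp ω hr) (by positivity)]
  refine (h ω r R hr hrR).trans ?_
  gcongr

lemma support_selfAffineMeasure_subset (hn : ∀ q, 2 ≤ n q) (p : PMF Λ) :
    (selfAffineMeasure Λ p).support ⊆ sponge Λ := by
  refine Measure.support_subset_of_isClosed (isCompact_sponge hn).isClosed ?_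
  rw [selfAffineMeasure, mem_ae_map_iff (measurable_codingMap hn).aemeasurable
    (isCompact_sponge hn).measurableSet]
  exact Filter.univ_mem' fun ω => ⟨ω, rfl⟩

lemma le_of_measure_ratio_le (hd : 0 < d) (hn : ∀ q, 2 ≤ n q) (hmono : StrictMono n)
    (hsep : VSSC Λ) {p : PMF Λ} (hp : ∀ i, 0 < p i) {s : Fin d → ℝ} (hs0 : ∀ q, 0 ≤ s q)
    {ω : ℕ → Λ} (hω : ∀ M : ℕ, 0 < M → ∃ N, 0 < N ∧
      ∀ q, ∀ t ∈ Finset.Ico (Nat.log (n q) N) (Nat.log (n q) (N * M)),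
        condProb Λ p q (ω t) = (n q : ℝ) ^ (-s q)) {S C : ℝ} (hC : 0 < C)
    (h : ∀ r R : ℝ, 0 < r → r < R →
      selfAffineMeasure Λ p (closedBall (codingMap Λ ω) R) /
        selfAffineMeasure Λ p (closedBall (codingMap Λ ω) r) ≤
        ENNReal.ofReal (C * (R / r) ^ S)) :
    ∑ q, s q ≤ S := by
  have := isProbabilityMeasure_selfAffineMeasure hn p
  have hD : 2 ≤ baseSum n := two_le_baseSum hd hn
  set D := baseSum n
  -- The radii `1 / (2 * N * M)` and `D / N` have ratio `2 * D * M`, so the unknown scale `N`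
  -- cancels and the constant is uniform in `M`.
  refine Real.le_of_forall_nat_rpow_le
    (K := (∏ q, (n q : ℝ) ^ s q) * C * (2 * D) ^ S) fun M hM => ?_
  obtain ⟨N, hN, hNM⟩ := hω M hM
  have hM' : (1 : ℝ) ≤ M := by exact_mod_cast hM
  have hN' : (1 : ℝ) ≤ N := by exact_mod_cast hN
  have hr : 0 < 1 / (2 * ((N : ℝ) * M)) := by positivity
  have hrR : 1 / (2 * ((N : ℝ) * M)) < D / N := by
    rw [div_lt_div_iff₀ (by positivity) (by positivity)]
    have h1 := mul_le_mul_of_nonneg_right hD (by positivity : 0 ≤ 2 * ((N : ℝ) * M))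
    have h2 : (N : ℝ) ≤ N * M := le_mul_of_one_le_right (by positivity) hM'
    linarith
  have hpos := real_closedBall_pos hn hmono hp ω hr
  have h1 := h _ _ hr hrR
  rw [measure_div_le_ofReal_iff hpos (by positivity),
    show D / N / (1 / (2 * ((N : ℝ) * M))) = 2 * D * M by field_simp,
    Real.mul_rpow (by positivity) (by positivity)] at h1
  have h2 := real_closedBall_mul_le hn hmono hsep hp hs0 hN hM hNM
  refine le_of_mul_le_mul_right ?_ hpos
  refine h2.trans ((mul_le_mul_of_nonneg_left h1 (by positivity)).trans_eq ?_)
  ring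

end BedfordMcMullen

theorem mainTheorem4 (d : ℕ) (hd : 2 ≤ d) (n : Fin d → ℕ) (hn : ∀ q, 2 ≤ n q)
    (hmono : StrictMono n) (Λ : Finset ((q : Fin d) → Fin (n q))) (hΛ : Λ.Nonempty)
    (hsep : BedfordMcMullen.VSSC Λ) (p : PMF Λ) (hp : ∀ i, 0 < p i) :
    assouadDim (BedfordMcMullen.selfAffineMeasure Λ p) =
        ENNReal.ofReal (∑ q : Fin d, Finset.univ.sup' (Finset.univ_nonempty_iff.2 hΛ.to_subtype)
          fun i : Λ => -Real.log (BedfordMcMullen.condProb Λ p q i) / Real.log (n q)) ∧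
      ∀ᵐ x ∂BedfordMcMullen.selfAffineMeasure Λ p, x ∈ BedfordMcMullen.sponge Λ ∧
        pointwiseAssouadDim (BedfordMcMullen.selfAffineMeasure Λ p) x =
          assouadDim (BedfordMcMullen.selfAffineMeasure Λ p) := by
  open BedfordMcMullen in
  have hne : Nonempty Λ := hΛ.to_subtype
  have hd0 : 0 < d := by omega
  have hprob := isProbabilityMeasure_selfAffineMeasure hn p
  have hlog (q : Fin d) : 0 < Real.log (n q) :=
    Real.log_pos (by exact_mod_cast (by have := hn q; omega : 1 < n q))
  have hn0 (q : Fin d) : (0 : ℝ) < n q := by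
    have := hn q
    exact_mod_cast (by omega : 0 < n q)
  set s : Fin d → ℝ := fun q => Finset.univ.sup' (Finset.univ_nonempty_iff.2 hΛ.to_subtype)
    fun i : Λ => -Real.log (condProb Λ p q i) / Real.log (n q) with hsdef
  have hrpow (q : Fin d) (i : Λ) :
      (n q : ℝ) ^ (-(-Real.log (condProb Λ p q i) / Real.log (n q))) = condProb Λ p q i := by
    rw [neg_div, neg_neg, Real.rpow_def_of_pos (hn0 q), mul_div_cancel₀ _ (hlog q).ne',
      Real.exp_log (condProb_pos hp q i)]
  have hle (q : Fin d) (i : Λ) : -Real.log (condProb Λ p q i) / Real.log (n q) ≤ s q :=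
    Finset.le_sup' (fun i : Λ => -Real.log (condProb Λ p q i) / Real.log (n q))
      (Finset.mem_univ i)
  have hs0 (q : Fin d) : 0 ≤ s q := by
    obtain ⟨i⟩ := hne
    refine le_trans (div_nonneg (neg_nonneg.2 ?_) (hlog q).le) (hle q i)
    exact Real.log_nonpos (condProb_pos hp q i).le (condProb_le_one hp q i)
  have hs (q : Fin d) (i : Λ) : (n q : ℝ) ^ (-s q) ≤ condProb Λ p q i := by
    rw [← hrpow q i]
    exact Real.rpow_le_rpow_of_exponent_le (by exact_mod_cast (hn q).trans' one_le_two)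
      (neg_le_neg (hle q i))
  have hv (q : Fin d) : ∃ i, condProb Λ p q i = (n q : ℝ) ^ (-s q) := by
    obtain ⟨i, -, hi⟩ := Finset.exists_mem_eq_sup' (Finset.univ_nonempty_iff.2 hΛ.to_subtype)
      fun i : Λ => -Real.log (condProb Λ p q i) / Real.log (n q)
    exact ⟨i, by rw [hsdef]; simp only [hi]; exact (hrpow q i).symm⟩
  choose v hv using hv
  have hS : 0 ≤ ∑ q, s q := Finset.sum_nonneg fun q _ => hs0 q
  have hupper : assouadDim (selfAffineMeasure Λ p) ≤ ENNReal.ofReal (∑ q, s q) := by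
    refine ENNReal.sInf_le_ofReal_of_forall_lt hS fun S hlt => ?_
    obtain ⟨C, hC, h⟩ := exists_measure_ratio_le hd0 hn hmono hsep hp hs0 hs hlt.le
    exact ⟨C, hC, fun x hx => h x (support_selfAffineMeasure_subset hn p hx)⟩
  have hlower : ∀ᵐ x ∂selfAffineMeasure Λ p, x ∈ sponge Λ ∧
      ENNReal.ofReal (∑ q, s q) ≤ pointwiseAssouadDim (selfAffineMeasure Λ p) x := by
    -- The measurable embedding transfers the statement to words without proving that the set of
    -- good points is measurable.
    rw [selfAffineMeasure, (measurableEmbedding_codingMap hn hmono hsep).ae_map_iff]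
    have hwin : ∀ᵐ ω ∂(Measure.infinitePi fun _ : ℕ => p.toMeasure), ∀ M : ℕ, 0 < M →
        ∃ N, 0 < N ∧ ∀ q, ∀ t ∈ Finset.Ico (Nat.log (n q) N) (Nat.log (n q) (N * M)),
          ω t = v q :=
      ae_all_iff.2 fun M => Filter.eventually_imp_distrib_left.2
        fun hM => ae_exists_window hn hmono hp v hM
    filter_upwards [hwin] with ω hω
    refine ⟨⟨ω, rfl⟩, le_sInf ?_⟩
    rintro _ ⟨S, -, rfl, C, hC, h⟩
    refine ENNReal.ofReal_le_ofReal
      (le_of_measure_ratio_le hd0 hn hmono hsep hp hs0 (fun M hM => ?_) hC h)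
    obtain ⟨N, hN, hN'⟩ := hω M hM
    exact ⟨N, hN, fun q t ht => by rw [hN' q t ht, hv q]⟩
  have hsupp : ∀ᵐ x ∂selfAffineMeasure Λ p, pointwiseAssouadDim (selfAffineMeasure Λ p) x ≤
      assouadDim (selfAffineMeasure Λ p) := by
    filter_upwards [Measure.support_mem_ae] with x hx
    exact pointwiseAssouadDim_le_assouadDim hx
  have heq : assouadDim (selfAffineMeasure Λ p) = ENNReal.ofReal (∑ q, s q) := by
    -- One typical point, which exists as the measure is a probability, bounds the global dimension
    -- from below.
    obtain ⟨x, hx1, hx2⟩ := (hlower.and hsupp).exists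
    exact le_antisymm hupper (hx1.2.trans hx2)
  refine ⟨heq, ?_⟩
  filter_upwards [hlower, hsupp] with x hx1 hx2
  exact ⟨hx1.1, le_antisymm hx2 (heq.le.trans hx1.2)⟩
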